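/- Consider a source with $N_s\ge 1$ antennas, $R\ge 1$ single-antenna amplify-and-forward relays and a destination with $N_d$ antennas. The source-relay coefficients $f_{n,r}$ ($1\le n\le N_s$, $1\le r\le R$) and the relay-destination coefficients $g_{r,j}$ ($1\le j\le N_d$) are mutually independent, circularly symmetric, zero-mean complex Gaussian with variances $\sigma_{f_r}^2>0$ and $\sigma_{g_r}^2>0$ (Rayleigh fading). The noise powers at the relays and at each destination antenna are $\mathcal N_1>0$ and $\mathcal N_2>0$. Put $\|g_r\|^2=\sum_j|g_{r,j}|^2$, $\xi_r=\max_n|f_{n,r}|^2$ and $\sigma_{\xi_r}^2=\mathbb E[\xi_r]$. If the source antennas transmit with powers $P_{1,n}$, $\sum_n P_{1,n}=P_1$, and the relays with average powers $P_{2,r}$, relay $r$ scales by $\rho_r=\sqrt{P_{2,r}/(\sigma_{\xi_r}^2P_1+\mathcal N_1)}$ and the received SNR is $$\mathrm{SNR}=\frac{\sum_{r}\sum_{n}P_{1,n}|f_{n,r}|^2\rho_r^2\|g_r\|^2}{\sum_{r}\rho_r^2\|g_r\|^2\mathcal N_1+N_d\mathcal N_2}.$$ In the full-opportunistic scheme with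 powers $P_1,P_2$, for each channel realization a relay $r^*$ maximizing $$\frac{\xi_r\|g_r\|^2}{P_2\|g_r\|^2\mathcal N_1+N_d\mathcal N_2(\sigma_{\xi_r}^2P_1+\mathcal N_1)}$$ is selected, then a source antenna $n^*$ maximizing $|f_{n,r^*}|^2$ (ties broken arbitrarily), and $P_{1,n^*}=P_1$, $P_{2,r^*}=P_2$, all other powers being $0$. Its average symbol error rate is $$P_e=\mathbb E\big[c\,Q(\sqrt{\kappa\,\mathrm{SNR}})\big],\qquad Q(x)=\frac1{\sqrt{2\pi}}\int_x^\infty e^{-u^2/2}\,du,$$ with modulation constants $c,\kappa>0$ ($c=2$, $\kappa=2\sin^2(\pi/M)$ for $M$-PSK; $c=4(\sqrt M-1)/\sqrt M$, $\kappa=3/(M-1)$ for $M$-QAM). Let the total power be $P=\mu\mathcal N_0$, where $\mu$ is the transmit SNR relative to a fixed reference noise power $\mathcal N_0>0$ (for instance $\mathcal N_1$ or $\mathcal N_2$), and let $P_1=\tau P$, $P_2=(1-\tau)P$, where $\tau$ may depend on $P$ but $\varepsilon\le\tau\le1-\varepsilon$ for some fixed $\varepsilon>0$ and all large $P$. If $N_s<N_d$,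 then the scheme has diversity order $N_sR$: $$-\lim_{\mu\to\infty}\frac{\log P_e(\mu)}{\log\mu}=N_sR.$$ -/

import Mathlib

open MeasureTheory ProbabilityTheory Filter Topology
open scoped NNReal

noncomputable section

/-- The law of a circularly symmetric zero-mean complex Gaussian variable `Z` with variance
`E |Z|² = v`: independent real and imaginary parts, each `N(0, v / 2)`. -/
def rayleighLaw (v : ℝ≥0) : Measure ℂ :=
  ((gaussianReal 0 (v / 2)).prod (gaussianReal 0 (v / 2))).map
    Complex.measurableEquivRealProd.symm

/-- Rayleigh fading: all source-relay coefficients `f n r` (antenna `n`, relay `r`) and all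
relay-destination coefficients `g r j` (relay `r`, antenna `j`) are mutually independent, zero-mean
complex Gaussian, of variances `σf2 r` and `σg2 r`. -/
structure IsRayleighFading {Ω : Type*} [MeasurableSpace Ω] (Pr : Measure Ω) {Ns Nd R : ℕ}
    (σf2 σg2 : Fin R → ℝ≥0) (f : Fin Ns → Fin R → Ω → ℂ) (g : Fin R → Fin Nd → Ω → ℂ) :
    Prop where
  law_f : ∀ n r, HasLaw (f n r) (rayleighLaw (σf2 r)) Pr
  law_g : ∀ r j, HasLaw (g r j) (rayleighLaw (σg2 r)) Pr
  indep : iIndepFun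
    (Sum.elim (fun p : Fin Ns × Fin R => f p.1 p.2) (fun p : Fin R × Fin Nd => g p.1 p.2)) Pr

/-- `ξ_r = max_n |f_{n,r}|²` for a realization `F` of the source-relay channels. -/
def bestAntennaGain {Ns R : ℕ} (F : Fin Ns → Fin R → ℂ) (r : Fin R) : ℝ :=
  ⨆ n, ‖F n r‖ ^ 2

/-- `‖g_r‖² = ∑_j |g_{r,j}|²` for a realization `G` of the relay-destination channels. -/
def forwardGain {R Nd : ℕ} (G : Fin R → Fin Nd → ℂ) (r : Fin R) : ℝ :=
  ∑ j, ‖G r j‖ ^ 2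

/-- `σ_{ξ_r}² = E[ξ_r]`. -/
def meanBestAntennaGain {Ω : Type*} [MeasurableSpace Ω] (Pr : Measure Ω) {Ns R : ℕ}
    (f : Fin Ns → Fin R → Ω → ℂ) (r : Fin R) : ℝ :=
  ∫ ω, bestAntennaGain (fun n r => f n r ω) r ∂Pr

/-- The amplification factor `ρ_r` of a relay transmitting with average power `p` when the source
power is `P₁`, the mean gain of its incoming channel is `m` and its noise power is `N₁`. -/
def ampFactor (m P₁ N₁ p : ℝ) : ℝ :=
  Real.sqrt (p / (m * P₁ + N₁))

/-- Received instantaneous SNR (signal power over noise power) at the destination when the source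
antennas transmit with powers `p₁ n`, the relays with average powers `p₂ r`; `m r` is the mean
source-relay gain that relay `r` uses for its scaling, `N₁`, `N₂` are the noise powers at the
relays and at the destination antennas. -/
def receivedSNR {Ns Nd R : ℕ} (m : Fin R → ℝ) (N₁ N₂ : ℝ) (p₁ : Fin Ns → ℝ) (p₂ : Fin R → ℝ)
    (F : Fin Ns → Fin R → ℂ) (G : Fin R → Fin Nd → ℂ) : ℝ :=
  (∑ r, ∑ n, p₁ n * ‖F n r‖ ^ 2 * ampFactor (m r) (∑ i, p₁ i) N₁ (p₂ r) ^ 2 * forwardGain G r) /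
    ((∑ r, ampFactor (m r) (∑ i, p₁ i) N₁ (p₂ r) ^ 2 * forwardGain G r * N₁) + Nd * N₂)

/-- The quantity by which the best relay is selected. -/
def relayMetric {Ns Nd R : ℕ} (m : Fin R → ℝ) (N₁ N₂ P₁ P₂ : ℝ)
    (F : Fin Ns → Fin R → ℂ) (G : Fin R → Fin Nd → ℂ) (r : Fin R) : ℝ :=
  bestAntennaGain F r * forwardGain G r /
    (P₂ * forwardGain G r * N₁ + Nd * N₂ * (m r * P₁ + N₁))

/-- Full-opportunistic selection for one channel realization: `r` is a best relay (ties broken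
arbitrarily) and `n` is a source antenna with the largest gain towards that relay. -/
structure IsFullOpportunistic {Ns Nd R : ℕ} (m : Fin R → ℝ) (N₁ N₂ P₁ P₂ : ℝ)
    (F : Fin Ns → Fin R → ℂ) (G : Fin R → Fin Nd → ℂ) (r : Fin R) (n : Fin Ns) : Prop where
  best_relay : ∀ k, relayMetric m N₁ N₂ P₁ P₂ F G k ≤ relayMetric m N₁ N₂ P₁ P₂ F G r
  best_antenna : ∀ i, ‖F i r‖ ^ 2 ≤ ‖F n r‖ ^ 2

/-- The Gaussian tail function `Q`. -/
def gaussianQ (x : ℝ) : ℝ :=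
  1 / Real.sqrt (2 * Real.pi) * ∫ u in Set.Ioi x, Real.exp (-u ^ 2 / 2)

/-- Average SER `E[c Q(√(κ SNR))]` when the whole source power `P₁` is put on antenna `nSel ω` and
the whole relay power `P₂` on relay `rSel ω`, all other antennas and relays being silent. The
relays scale with the means of the `ξ_r`. -/
def averageSER {Ω : Type*} [MeasurableSpace Ω] (Pr : Measure Ω) {Ns Nd R : ℕ}
    (f : Fin Ns → Fin R → Ω → ℂ) (g : Fin R → Fin Nd → Ω → ℂ) (N₁ N₂ c κ P₁ P₂ : ℝ)
    (rSel : Ω → Fin R) (nSel : Ω → Fin Ns) : ℝ :=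
  ∫ ω, c * gaussianQ (Real.sqrt (κ *
    receivedSNR (meanBestAntennaGain Pr f) N₁ N₂ (Pi.single (nSel ω) P₁) (Pi.single (rSel ω) P₂)
      (fun n r => f n r ω) (fun r j => g r j ω))) ∂Pr

/-- The error rate `Pe`, as a function of the transmit SNR `μ`, has diversity order `d`:
`d = - lim_{μ → ∞} log Pe(μ) / log μ`. -/
def HasDiversityOrder (Pe : ℝ → ℝ) (d : ℝ) : Prop :=
  Tendsto (fun μ => -(Real.log (Pe μ) / Real.log μ)) atTop (𝓝 d)

end

/-! Because the best relay and antenna are selected, the SNR is `P₁ P₂` times the largest relay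
metric; both bounds start from this expression.

Lower bound: forwarding cannot improve on the first hop, so the SNR is at most `P₁ max_r ξ_r / N₁`
(`mul_relayMetric_le`). It stays bounded when all `Ns R` gains `|f_{n,r}|²` are at most `1 / P`, an
event of probability at least a constant times `P ^ (-Ns R)`, and there `Q` is bounded below
(`le_averageSER`).

Upper bound: the SNR dominates a multiple of `P ξ_r ‖g_r‖² / (1 + ‖g_r‖²)` for every `r`
(`le_mul_relayMetric`). As `Ns ≤ Nd`, its power `Ns R` then dominates a multiple of `P ^ (Ns R) W`,
where `W` is the product of all channel gains truncated at `1` (`prod_gain_le_pow`). Since `Q(√y)`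
is at most a multiple of `y ^ (-Ns R β)`, the SER is at most a multiple of `P ^ (-Ns R β) E[W ^
(-β)]`. By independence this moment factors, and each factor is finite for `β < 1`. Letting `β` tend
to `1` closes the gap (`hasDiversityOrder_of_le`), so no exact asymptotics are needed. -/

/-! ### The Gaussian tail function -/

lemma integrable_exp_neg_sq_div_two : Integrable fun u : ℝ => Real.exp (-u ^ 2 / 2) := by
  refine (integrable_exp_neg_mul_sq (b := 1 / 2) (by norm_num)).congr (.of_forall fun u => ?_)
  show Real.exp _ = Real.exp _
  congr 1
  ring

lemma gaussianQ_nonneg (x : ℝ) : 0 ≤ gaussianQ x :=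
  mul_nonneg (by positivity) (integral_nonneg fun _ => (Real.exp_pos _).le)

lemma gaussianQ_antitone : Antitone gaussianQ := fun x y h => by
  refine mul_le_mul_of_nonneg_left ?_ (by positivity)
  exact setIntegral_mono_set integrable_exp_neg_sq_div_two.integrableOn
    (.of_forall fun _ => (Real.exp_pos _).le) (Set.Ioi_subset_Ioi h).eventuallyLE

lemma gaussianQ_pos (x : ℝ) : 0 < gaussianQ x := by
  refine mul_pos (by positivity) ?_
  rw [setIntegral_pos_iff_support_of_nonneg_ae (.of_forall fun _ => (Real.exp_pos _).le)
    integrable_exp_neg_sq_div_two.integrableOn]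
  have : (Function.support fun u : ℝ => Real.exp (-u ^ 2 / 2)) = Set.univ :=
    Set.eq_univ_of_forall fun u => (Real.exp_pos _).ne'
  simp [this]

/-- The Gaussian tail decays faster than every power. -/
lemma exists_gaussianQ_sqrt_le {p : ℝ} (hp : 0 < p) :
    ∃ C > 0, ∀ y > 0, gaussianQ (Real.sqrt y) ≤ C * y ^ (-p) := by
  have hint : Integrable fun u : ℝ => u ^ (2 * p) * Real.exp (-u ^ 2 / 2) := by
    refine (integrable_rpow_mul_exp_neg_mul_sq (b := 1 / 2) (by norm_num)
      (s := 2 * p) (by linarith)).congr (.of_forall fun u => ?_)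
    show _ * Real.exp _ = _ * Real.exp _
    congr 2
    ring
  set J := ∫ u in Set.Ioi (0 : ℝ), u ^ (2 * p) * Real.exp (-u ^ 2 / 2)
  have hJ0 : 0 ≤ J := setIntegral_nonneg measurableSet_Ioi fun u hu =>
    mul_nonneg (Real.rpow_nonneg (le_of_lt hu) _) (Real.exp_pos _).le
  -- `J + 1` rather than `J` makes the constant positive with only `0 ≤ J` at hand.
  refine ⟨1 / Real.sqrt (2 * Real.pi) * (J + 1), by positivity, fun y hy => ?_⟩
  rw [gaussianQ, mul_assoc]
  refine mul_le_mul_of_nonneg_left ?_ (by positivity)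
  have hs : 0 < Real.sqrt y := Real.sqrt_pos.2 hy
  have hyp : 0 < y ^ (-p) := Real.rpow_pos_of_pos hy _
  calc ∫ u in Set.Ioi (Real.sqrt y), Real.exp (-u ^ 2 / 2)
      -- Chebyshev's trick: `1 ≤ (u² / y) ^ p` on the range of integration.
      ≤ ∫ u in Set.Ioi (Real.sqrt y), y ^ (-p) * (u ^ (2 * p) * Real.exp (-u ^ 2 / 2)) := by
        refine setIntegral_mono_on integrable_exp_neg_sq_div_two.integrableOn
          (hint.const_mul _).integrableOn measurableSet_Ioi fun u hu => ?_
        have hu' : Real.sqrt y < u := hu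
        have hyu : y ≤ u ^ (2 : ℝ) := by
          rw [Real.rpow_two]
          exact (Real.sqrt_le_left (hs.trans hu').le).1 hu'.le
        rw [← mul_assoc]
        refine le_mul_of_one_le_left (Real.exp_pos _).le ?_
        rw [Real.rpow_neg hy.le, ← div_eq_inv_mul, one_le_div (Real.rpow_pos_of_pos hy _),
          Real.rpow_mul (hs.trans hu').le]
        exact Real.rpow_le_rpow hy.le hyu hp.le
    _ = y ^ (-p) * ∫ u in Set.Ioi (Real.sqrt y), u ^ (2 * p) * Real.exp (-u ^ 2 / 2) :=
        integral_const_mul _ _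
    _ ≤ y ^ (-p) * J := by
        refine mul_le_mul_of_nonneg_left ?_ hyp.le
        refine setIntegral_mono_set hint.integrableOn ?_ (Set.Ioi_subset_Ioi hs.le).eventuallyLE
        filter_upwards [ae_restrict_mem measurableSet_Ioi] with u hu
        exact mul_nonneg (Real.rpow_nonneg (le_of_lt hu) _) (Real.exp_pos _).le
    _ ≤ (J + 1) * y ^ (-p) := by nlinarith

/-! ### Behaviour of Gaussian laws near zero -/

lemma intervalIntegrable_abs_rpow {r : ℝ} (hr : -1 < r) :
    IntervalIntegrable (fun x : ℝ => |x| ^ r) volume (-1) 1 := by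
  have h1 : IntervalIntegrable (fun x : ℝ => |x| ^ r) volume 0 1 := by
    refine (intervalIntegral.intervalIntegrable_rpow' hr).congr fun x hx => ?_
    rw [Set.uIoc_of_le zero_le_one] at hx
    simp only [abs_of_pos hx.1]
  have h2 := (IntervalIntegrable.iff_comp_neg (f := fun x : ℝ => |x| ^ r)).1 h1
  simp only [abs_neg, neg_zero] at h2
  exact h2.symm.trans h1

lemma lintegral_abs_rpow_neg_lt_top {β : ℝ} (h1 : β < 1) :
    ∫⁻ x in Set.Ioc (-1 : ℝ) 1, ENNReal.ofReal |x| ^ (-β) < ⊤ := by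
  have h := (intervalIntegrable_abs_rpow (r := -β) (by linarith)).1
  have h' := h.lintegral_lt_top
  refine lt_of_le_of_lt (le_of_eq ?_) h'
  refine lintegral_congr_ae (ae_restrict_of_ae ?_)
  -- The extended and the real power can differ at `x = 0`, which is a null set.
  filter_upwards [compl_mem_ae_iff.2 (measure_singleton (0 : ℝ))] with x hx
  exact ENNReal.ofReal_rpow_of_pos (abs_pos.2 hx)

lemma gaussianPDF_zero_le (v : ℝ≥0) (x : ℝ) :
    gaussianPDF 0 v x ≤ ENNReal.ofReal (Real.sqrt (2 * Real.pi * v))⁻¹ := by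
  rw [gaussianPDF, gaussianPDFReal]
  refine ENNReal.ofReal_le_ofReal (mul_le_of_le_one_right (by positivity) ?_)
  rw [Real.exp_le_one_iff]
  exact div_nonpos_of_nonpos_of_nonneg (neg_nonpos.2 (sq_nonneg _)) (by positivity)

/-- Negative moments of order less than one of a truncated real Gaussian variable. -/
lemma lintegral_gaussianReal_min_abs_rpow_neg_lt_top {v : ℝ≥0} (hv : v ≠ 0) {β : ℝ} (h1 : β < 1) :
    ∫⁻ x, ENNReal.ofReal (min 1 |x|) ^ (-β) ∂gaussianReal 0 v < ⊤ := by
  set D := ENNReal.ofReal (Real.sqrt (2 * Real.pi * v))⁻¹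
  have hle : ∀ x : ℝ, ENNReal.ofReal (min 1 |x|) ^ (-β) ≤
      1 + (Set.Icc (-1 : ℝ) 1).indicator (fun x => ENNReal.ofReal |x| ^ (-β)) x := by
    intro x
    by_cases hx : |x| ≤ 1
    · rw [min_eq_right hx, Set.indicator_of_mem (Set.mem_Icc.2 (abs_le.1 hx))]
      exact le_add_self
    · rw [min_eq_left (not_le.1 hx).le]
      simp
  refine (lintegral_mono hle).trans_lt ?_
  rw [lintegral_add_left measurable_const, lintegral_indicator measurableSet_Icc,
    gaussianReal_of_var_ne_zero _ hv]
  refine ENNReal.add_lt_top.2 ⟨?_, ?_⟩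
  · rw [← gaussianReal_of_var_ne_zero _ hv]
    simp
  · rw [restrict_withDensity measurableSet_Icc,
      lintegral_withDensity_eq_lintegral_mul _ (measurable_gaussianPDF _ _) (by fun_prop)]
    calc ∫⁻ x in Set.Icc (-1 : ℝ) 1, (gaussianPDF 0 v * fun x => ENNReal.ofReal |x| ^ (-β)) x
        ≤ ∫⁻ x in Set.Icc (-1 : ℝ) 1, D * ENNReal.ofReal |x| ^ (-β) :=
          lintegral_mono fun x => mul_le_mul_left (gaussianPDF_zero_le v x) _
      _ = D * ∫⁻ x in Set.Icc (-1 : ℝ) 1, ENNReal.ofReal |x| ^ (-β) :=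
          lintegral_const_mul _ (by fun_prop)
      _ < ⊤ := by
          refine ENNReal.mul_lt_top ENNReal.ofReal_lt_top ?_
          rw [← restrict_Ioc_eq_restrict_Icc]
          exact lintegral_abs_rpow_neg_lt_top h1

/-- On `[-1, 1]` the density is at least its value at `1`, which serves as the constant. -/
lemma gaussianReal_Icc_ge {v : ℝ≥0} (hv : v ≠ 0) :
    ∃ c > 0, ∀ t ∈ Set.Icc (0 : ℝ) 1, c * t ≤ (gaussianReal 0 v).real (Set.Icc (-t) t) := by
  refine ⟨gaussianPDFReal 0 v 1, gaussianPDFReal_pos _ _ _ hv, fun t ht => ?_⟩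
  rw [Measure.real, gaussianReal_apply_eq_integral _ hv, ENNReal.toReal_ofReal
    (integral_nonneg fun x => gaussianPDFReal_nonneg _ _ _)]
  calc gaussianPDFReal 0 v 1 * t ≤ ∫ x in Set.Icc (-t) t, gaussianPDFReal 0 v 1 := by
        have := gaussianPDFReal_nonneg 0 v 1
        simp only [setIntegral_const, Real.volume_real_Icc, smul_eq_mul]
        rw [max_eq_left (by linarith [ht.1])]
        nlinarith [ht.1]
    _ ≤ _ := by
        refine setIntegral_mono_on (integrable_const _)
          (integrable_gaussianPDFReal _ _).integrableOn measurableSet_Icc fun x hx => ?_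
        simp only [gaussianPDFReal, sub_zero]
        have hx2 : x ^ 2 ≤ 1 ^ 2 := by
          rw [sq_le_sq, abs_one]
          exact abs_le.2 ⟨by linarith [hx.1, ht.2], by linarith [hx.2, ht.2]⟩
        gcongr

instance (v : ℝ≥0) : IsProbabilityMeasure (rayleighLaw v) :=
  Measure.isProbabilityMeasure_map (MeasurableEquiv.measurable _).aemeasurable

/-- Since `x² + y² ≥ |x| |y|`, the integrand is at most a product of functions of the real and
imaginary parts, which reduces the claim to two real negative moments of the same order `β`. -/
lemma lintegral_rayleighLaw_min_rpow_neg_lt_top {v : ℝ≥0} (hv : 0 < v) {β : ℝ} (h0 : 0 < β)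
    (h1 : β < 1) :
    ∫⁻ z, ENNReal.ofReal (min 1 (‖z‖ ^ 2)) ^ (-β) ∂rayleighLaw v < ⊤ := by
  have hv' : v / 2 ≠ 0 := by positivity
  rw [rayleighLaw, lintegral_map_equiv]
  have hle : ∀ p : ℝ × ℝ,
      ENNReal.ofReal (min 1 (‖Complex.measurableEquivRealProd.symm p‖ ^ 2)) ^ (-β) ≤
        ENNReal.ofReal (min 1 |p.1|) ^ (-β) * ENNReal.ofReal (min 1 |p.2|) ^ (-β) := by
    intro p
    rw [← ENNReal.mul_rpow_of_ne_top ENNReal.ofReal_ne_top ENNReal.ofReal_ne_top,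
      ← ENNReal.ofReal_mul (by positivity)]
    rw [ENNReal.rpow_neg, ENNReal.rpow_neg, ENNReal.inv_le_inv]
    refine ENNReal.rpow_le_rpow (ENNReal.ofReal_le_ofReal ?_) h0.le
    rw [Complex.measurableEquivRealProd_symm_apply, ← Complex.normSq_eq_norm_sq,
      Complex.normSq_mk]
    have ha : min 1 |p.1| ≤ |p.1| := min_le_right _ _
    have hb : min 1 |p.2| ≤ |p.2| := min_le_right _ _
    refine le_min (mul_le_one₀ (min_le_left _ _) (by positivity) (min_le_left _ _)) ?_
    refine (mul_le_mul ha hb (by positivity) (abs_nonneg _)).trans ?_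
    nlinarith [abs_mul_abs_self p.1, abs_mul_abs_self p.2, sq_nonneg (|p.1| - |p.2|),
      mul_nonneg (abs_nonneg p.1) (abs_nonneg p.2)]
  refine (lintegral_mono hle).trans_lt ?_
  rw [lintegral_prod_mul (f := fun x => ENNReal.ofReal (min 1 |x|) ^ (-β))
    (g := fun x => ENNReal.ofReal (min 1 |x|) ^ (-β)) (by fun_prop) (by fun_prop)]
  exact ENNReal.mul_lt_top (lintegral_gaussianReal_min_abs_rpow_neg_lt_top hv' h1)
    (lintegral_gaussianReal_min_abs_rpow_neg_lt_top hv' h1)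

/-- The squared modulus of a complex Gaussian variable is near `0` with at least linear
probability. -/
lemma exists_rayleighLaw_ge {v : ℝ≥0} (hv : 0 < v) :
    ∃ c > 0, ∀ δ ∈ Set.Icc (0 : ℝ) 1, c * δ ≤ (rayleighLaw v).real {z | ‖z‖ ^ 2 ≤ δ} := by
  have hv' : v / 2 ≠ 0 := by positivity
  obtain ⟨c, hc, h⟩ := gaussianReal_Icc_ge hv'
  refine ⟨c ^ 2 / 2, by positivity, fun δ hδ => ?_⟩
  -- The square `[-t, t]²` is inscribed in the disc `‖z‖² ≤ δ`.
  set t := Real.sqrt (δ / 2)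
  have ht2 : t ^ 2 = δ / 2 := Real.sq_sqrt (by linarith [hδ.1])
  have ht0 : 0 ≤ t := Real.sqrt_nonneg _
  have ht : t ∈ Set.Icc (0 : ℝ) 1 := ⟨ht0, by nlinarith [hδ.2]⟩
  rw [rayleighLaw, map_measureReal_apply (MeasurableEquiv.measurable _)
    (measurableSet_le (by fun_prop) measurable_const)]
  calc c ^ 2 / 2 * δ = (c * t) * (c * t) := by linear_combination (-c ^ 2) * ht2
    _ ≤ (gaussianReal 0 (v / 2)).real (Set.Icc (-t) t) *
        (gaussianReal 0 (v / 2)).real (Set.Icc (-t) t) :=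
        mul_self_le_mul_self (by positivity) (h t ht)
    _ = ((gaussianReal 0 (v / 2)).prod (gaussianReal 0 (v / 2))).real
        (Set.Icc (-t) t ×ˢ Set.Icc (-t) t) := (measureReal_prod_prod _ _).symm
    _ ≤ _ := by
        refine measureReal_mono fun p hp => ?_
        obtain ⟨hx, hy⟩ := hp
        simp only [Set.mem_preimage, Set.mem_ofPred_eq]
        rw [Complex.measurableEquivRealProd_symm_apply, ← Complex.normSq_eq_norm_sq,
          Complex.normSq_mk]
        have h1 : p.1 ^ 2 ≤ t ^ 2 := sq_le_sq' hx.1 hx.2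
        have h2 : p.2 ^ 2 ≤ t ^ 2 := sq_le_sq' hy.1 hy.2
        nlinarith

/-- The `Z i` are only a.e. measurable, so the product formula is applied to measurable versions. -/
lemma lintegral_prod_eq_prod_lintegral_comp {Ω ι E : Type*} [MeasurableSpace Ω]
    [MeasurableSpace E] [Fintype ι] {Pr : Measure Ω} {Z : ι → Ω → E} (hZ : iIndepFun Z Pr)
    (hm : ∀ i, AEMeasurable (Z i) Pr) {ψ : E → ENNReal} (hψ : Measurable ψ) :
    ∫⁻ ω, ∏ i, ψ (Z i ω) ∂Pr = ∏ i, ∫⁻ ω, ψ (Z i ω) ∂Pr := by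
  have hind : iIndepFun (fun i => (hm i).mk (Z i)) Pr :=
    iIndepFun.congr (fun i => (hm i).ae_eq_mk) hZ
  have h := lintegral_prod_eq_prod_lintegral_of_indepFun Finset.univ _
    (hind.comp (fun _ => ψ) fun _ => hψ) fun i => hψ.comp (hm i).measurable_mk
  have hae : ∀ᵐ ω ∂Pr, ∀ i, Z i ω = (hm i).mk (Z i) ω := ae_all_iff.2 fun i => (hm i).ae_eq_mk
  calc _ = ∫⁻ ω, ∏ i, (ψ ∘ (hm i).mk (Z i)) ω ∂Pr := lintegral_congr_ae <| by
        filter_upwards [hae] with ω hω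
        simp [hω]
    _ = _ := h
    _ = _ := Finset.prod_congr rfl fun i _ => lintegral_congr_ae <| by
        filter_upwards [hae] with ω hω
        simp [← hω]

/-- A function squeezed between `c μ ^ (-d)` and `C μ ^ (-d β)` for every `β < 1` has diversity
order `d`. -/
lemma hasDiversityOrder_of_le {Pe : ℝ → ℝ} {d : ℝ} (hd : 0 < d)
    (hlow : ∃ c > 0, ∀ᶠ μ in atTop, c * μ ^ (-d) ≤ Pe μ)
    (hup : ∀ β, 0 < β → β < 1 → ∃ C > 0, ∀ᶠ μ in atTop, Pe μ ≤ C * μ ^ (-(d * β))) :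
    HasDiversityOrder Pe d := by
  obtain ⟨c, hc, hlow⟩ := hlow
  have hlim : ∀ C b : ℝ, Tendsto (fun μ : ℝ => b - Real.log C / Real.log μ) atTop (𝓝 b) := by
    intro C b
    simpa using tendsto_const_nhds.sub (Real.tendsto_log_atTop.const_div_atTop (Real.log C))
  have hlog : ∀ᶠ μ : ℝ in atTop, 0 < Real.log μ := Real.tendsto_log_atTop.eventually_gt_atTop 0
  have hid : ∀ {K μ : ℝ} (b : ℝ), 0 < K → 0 < μ → 0 < Real.log μ →
      -(Real.log (K * μ ^ (-b)) / Real.log μ) = b - Real.log K / Real.log μ := by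
    intro K μ b hK hμ hl
    rw [Real.log_mul hK.ne' (Real.rpow_pos_of_pos hμ _).ne', Real.log_rpow hμ]
    field_simp
    ring
  refine tendsto_order.2 ⟨fun a ha => ?_, fun a ha => ?_⟩
  -- Any `β` between `max 0 (a / d)` and `1` works; the maximum covers negative `a`.
  · obtain ⟨β, hβ0, hβ1, hβ⟩ : ∃ β : ℝ, 0 < β ∧ β < 1 ∧ a < d * β := by
      obtain ⟨β, h1, h2⟩ := exists_between (max_lt zero_lt_one ((div_lt_one hd).2 ha))
      refine ⟨β, (le_max_left _ _).trans_lt h1, h2, ?_⟩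
      exact (div_lt_iff₀' hd).1 ((le_max_right _ _).trans_lt h1)
    obtain ⟨C, hC, hup⟩ := hup β hβ0 hβ1
    filter_upwards [hlow, hup, hlog, eventually_gt_atTop 0,
      (hlim C (d * β)).eventually (lt_mem_nhds hβ)] with μ h1 h2 h3 h4 h5
    refine h5.trans_le ?_
    rw [← hid _ hC h4 h3]
    have : 0 < Pe μ := (mul_pos hc (Real.rpow_pos_of_pos h4 _)).trans_le h1
    gcongr
  · filter_upwards [hlow, hlog, eventually_gt_atTop 0,
      (hlim c d).eventually (gt_mem_nhds ha)] with μ h1 h3 h4 h5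
    refine lt_of_le_of_lt ?_ h5
    rw [← hid _ hc h4 h3]
    have : 0 < c * μ ^ (-d) := mul_pos hc (Real.rpow_pos_of_pos h4 _)
    gcongr

/-! ### Bounds for a fixed channel realization -/

section Deterministic

variable {Ns Nd R : ℕ} {m : Fin R → ℝ} {N₁ N₂ P₁ P₂ : ℝ} {F : Fin Ns → Fin R → ℂ}
  {G : Fin R → Fin Nd → ℂ}

lemma forwardGain_nonneg (G : Fin R → Fin Nd → ℂ) (r : Fin R) : 0 ≤ forwardGain G r :=
  Finset.sum_nonneg fun _ _ => by positivity

lemma bestAntennaGain_nonneg (F : Fin Ns → Fin R → ℂ) (r : Fin R) : 0 ≤ bestAntennaGain F r :=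
  Real.iSup_nonneg fun _ => by positivity

lemma le_bestAntennaGain (F : Fin Ns → Fin R → ℂ) (n : Fin Ns) (r : Fin R) :
    ‖F n r‖ ^ 2 ≤ bestAntennaGain F r :=
  le_ciSup (f := fun n => ‖F n r‖ ^ 2) (Set.finite_range _).bddAbove n

lemma meanBestAntennaGain_nonneg {Ω : Type*} [MeasurableSpace Ω] (Pr : Measure Ω)
    (f : Fin Ns → Fin R → Ω → ℂ) (r : Fin R) : 0 ≤ meanBestAntennaGain Pr f r :=
  integral_nonneg fun _ => bestAntennaGain_nonneg _ _

lemma receivedSNR_single (h₁ : ∀ r, 0 < m r * P₁ + N₁) (h₂ : 0 ≤ P₂) {r : Fin R} {n : Fin Ns}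
    (hn : ∀ i, ‖F i r‖ ^ 2 ≤ ‖F n r‖ ^ 2) :
    receivedSNR m N₁ N₂ (Pi.single n P₁) (Pi.single r P₂) F G =
      P₁ * P₂ * relayMetric m N₁ N₂ P₁ P₂ F G r := by
  have hbest : bestAntennaGain F r = ‖F n r‖ ^ 2 := by
    have : Nonempty (Fin Ns) := ⟨n⟩
    exact le_antisymm (ciSup_le hn) (le_bestAntennaGain F n r)
  have hz : ∀ k ≠ r, ampFactor (m k) P₁ N₁ (Pi.single (M := fun _ => ℝ) r P₂ k) = 0 := fun k hk => by
    simp [ampFactor, hk]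
  have hr : ampFactor (m r) P₁ N₁ P₂ ^ 2 = P₂ / (m r * P₁ + N₁) :=
    Real.sq_sqrt (div_nonneg h₂ (h₁ r).le)
  rw [receivedSNR, Finset.sum_pi_single' n P₁, if_pos (Finset.mem_univ n)]
  rw [Finset.sum_eq_single r (fun k _ hk => by simp [hz k hk]) (by simp),
    Finset.sum_eq_single r (fun k _ hk => by simp [hz k hk]) (by simp),
    Finset.sum_eq_single n (fun i _ hi => by simp [hi]) (by simp)]
  simp only [Pi.single_eq_same, hr, relayMetric, hbest]
  have h0 := (h₁ r).ne'
  have hden : P₂ / (m r * P₁ + N₁) * forwardGain G r * N₁ + Nd * N₂ =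
      (P₂ * forwardGain G r * N₁ + Nd * N₂ * (m r * P₁ + N₁)) / (m r * P₁ + N₁) := by
    field_simp
  have hnum : P₁ * ‖F n r‖ ^ 2 * (P₂ / (m r * P₁ + N₁)) * forwardGain G r =
      P₁ * P₂ * (‖F n r‖ ^ 2 * forwardGain G r) / (m r * P₁ + N₁) := by
    field_simp
  rw [hden, hnum, div_div_div_cancel_right₀ h0, mul_div_assoc]

lemma IsFullOpportunistic.relayMetric_eq_iSup {r : Fin R} {n : Fin Ns}
    (h : IsFullOpportunistic m N₁ N₂ P₁ P₂ F G r n) :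
    relayMetric m N₁ N₂ P₁ P₂ F G r = ⨆ k, relayMetric m N₁ N₂ P₁ P₂ F G k := by
  have : Nonempty (Fin R) := ⟨r⟩
  exact le_antisymm (le_ciSup (Set.finite_range _).bddAbove r) (ciSup_le h.best_relay)

/-- The right-hand side is free of the selected indices, so the selection maps need not be
measurable and ties do not matter. -/
lemma IsFullOpportunistic.receivedSNR_eq {r : Fin R} {n : Fin Ns}
    (h : IsFullOpportunistic m N₁ N₂ P₁ P₂ F G r n) (h₁ : ∀ r, 0 < m r * P₁ + N₁) (h₂ : 0 ≤ P₂) :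
    receivedSNR m N₁ N₂ (Pi.single n P₁) (Pi.single r P₂) F G =
      P₁ * P₂ * ⨆ k, relayMetric m N₁ N₂ P₁ P₂ F G k := by
  rw [receivedSNR_single h₁ h₂ h.best_antenna, h.relayMetric_eq_iSup]

/-- Dropping the destination noise from the denominator leaves the SNR of the first hop. -/
lemma mul_relayMetric_le (hm : ∀ r, 0 ≤ m r) (hN₁ : 0 < N₁) (hN₂ : 0 < N₂) (h₁ : 0 ≤ P₁)
    (h₂ : 0 ≤ P₂) (r : Fin R) :
    P₁ * P₂ * relayMetric m N₁ N₂ P₁ P₂ F G r ≤ P₁ * bestAntennaGain F r / N₁ := by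
  have hg := forwardGain_nonneg G r
  have hb := bestAntennaGain_nonneg F r
  have hb' : 0 ≤ Nd * N₂ * (m r * P₁ + N₁) := by have := hm r; positivity
  rw [relayMetric]
  -- When `P₂ ‖g_r‖² = 0` the denominator may vanish (if `Nd = 0`), but the numerator is zero as
  -- well.
  rcases (mul_nonneg h₂ hg).eq_or_lt with h | h
  · rw [mul_div_assoc', show P₁ * P₂ * (bestAntennaGain F r * forwardGain G r) =
      P₁ * bestAntennaGain F r * (P₂ * forwardGain G r) by ring, ← h]
    simp only [mul_zero, zero_div]
    positivity
  · rw [mul_div_assoc', div_le_div_iff₀ (by positivity) hN₁]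
    have : 0 ≤ P₁ * bestAntennaGain F r * (Nd * N₂ * (m r * P₁ + N₁)) := by positivity
    nlinarith

lemma le_mul_relayMetric (hm : ∀ r, 0 ≤ m r) (hN₁ : 0 < N₁) (hN₂ : 0 < N₂) {ε P : ℝ} (hε : 0 < ε)
    (hP : 1 ≤ P) (h₁ : ε * P ≤ P₁) (h₁' : P₁ ≤ P) (h₂ : ε * P ≤ P₂) (h₂' : P₂ ≤ P)
    (hNd : 0 < Nd) (r : Fin R) :
    ε ^ 2 / (N₁ + Nd * N₂ * ((∑ k, m k) + N₁)) * P *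
        (bestAntennaGain F r * (forwardGain G r / (1 + forwardGain G r))) ≤
      P₁ * P₂ * relayMetric m N₁ N₂ P₁ P₂ F G r := by
  have hg := forwardGain_nonneg G r
  have hb := bestAntennaGain_nonneg F r
  set g := forwardGain G r
  set K := N₁ + Nd * N₂ * ((∑ k, m k) + N₁) with hK
  have hmr : m r ≤ ∑ k, m k := Finset.single_le_sum (fun k _ => hm k) (Finset.mem_univ r)
  have hm0 := hm r
  have hs0 := hm0.trans hmr
  have hNd' : (0 : ℝ) < Nd := by exact_mod_cast hNd
  have hP0 : 0 < P := by linarith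
  have hP₁ : 0 < P₁ := (by positivity : 0 < ε * P).trans_le h₁
  have hP₂ : 0 < P₂ := (by positivity : 0 < ε * P).trans_le h₂
  have hK0 : 0 < K := by positivity
  have hD0 : 0 < P₂ * g * N₁ + Nd * N₂ * (m r * P₁ + N₁) := by positivity
  have hD : P₂ * g * N₁ + Nd * N₂ * (m r * P₁ + N₁) ≤ P * (K * (1 + g)) := by
    have e1 : P₂ * g * N₁ ≤ P * g * N₁ := by gcongr
    -- `1 ≤ P` absorbs the constant noise term into a multiple of `P`.
    have e2 : m r * P₁ + N₁ ≤ (∑ k, m k) * P + N₁ * P := by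
      gcongr
      nlinarith
    have e3 : Nd * N₂ * (m r * P₁ + N₁) ≤ Nd * N₂ * ((∑ k, m k) * P + N₁ * P) := by gcongr
    -- These are the terms of `P * (K * (1 + g))` that the estimate does not use.
    have e4 : 0 ≤ P * (N₁ + Nd * N₂ * ((∑ k, m k) + N₁) * g) := by positivity
    rw [hK]
    nlinarith
  calc ε ^ 2 / K * P * (bestAntennaGain F r * (g / (1 + g)))
      = (ε * P) * (ε * P) * (bestAntennaGain F r * g / (P * (K * (1 + g)))) := by
        field_simp
    _ ≤ P₁ * P₂ * (bestAntennaGain F r * g / (P₂ * g * N₁ + Nd * N₂ * (m r * P₁ + N₁))) := by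
        gcongr

/-- Each truncated gain of the second hop is at most `min 1 ‖g_r‖² ≤ 1`, so the exponent `Nd` of
their product may be lowered to `Ns`. The factor `1 / 2` comes from `x / (1 + x) ≥ min 1 x / 2`. -/
lemma prod_min_one_sq_le (h : Ns ≤ Nd) (r : Fin R) :
    (1 / 2) ^ Ns * ((∏ n, min 1 (‖F n r‖ ^ 2)) * ∏ j, min 1 (‖G r j‖ ^ 2)) ≤
      (bestAntennaGain F r * (forwardGain G r / (1 + forwardGain G r))) ^ Ns := by
  have hg := forwardGain_nonneg G r
  have hb := bestAntennaGain_nonneg F r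
  set g := forwardGain G r
  have h1 : ∏ n, min 1 (‖F n r‖ ^ 2) ≤ bestAntennaGain F r ^ Ns := by
    refine (Finset.prod_le_prod (fun _ _ => by positivity)
      fun n _ => (min_le_right _ _).trans (le_bestAntennaGain F n r)).trans ?_
    simp
  have h2 : ∏ j, min 1 (‖G r j‖ ^ 2) ≤ min 1 g ^ Ns := by
    refine (Finset.prod_le_prod (g := fun _ => min 1 g) (fun _ _ => by positivity)
      fun j _ => min_le_min_left _ ?_).trans ?_
    · exact Finset.single_le_sum (f := fun j => ‖G r j‖ ^ 2) (fun _ _ => by positivity)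
        (Finset.mem_univ j)
    · rw [Finset.prod_const, Finset.card_univ, Fintype.card_fin]
      exact pow_le_pow_of_le_one (by positivity) (min_le_left _ _) h
  have h3 : 1 / 2 * min 1 g ≤ g / (1 + g) := by
    rw [le_div_iff₀ (by positivity)]
    rcases le_total 1 g with h | h
    · rw [min_eq_left h]; linarith
    · rw [min_eq_right h]; nlinarith
  calc _ ≤ (1 / 2) ^ Ns * (bestAntennaGain F r ^ Ns * min 1 g ^ Ns) := by gcongr
    _ = (bestAntennaGain F r * (1 / 2 * min 1 g)) ^ Ns := by ring
    _ ≤ _ := by gcongr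

/-- If `y` dominates a multiple of every relay's `ξ g / (1 + g)`, then `y ^ (Ns R)` dominates the
product of all truncated channel gains. -/
lemma prod_gain_le_pow (h : Ns ≤ Nd) {b y : ℝ} (hb : 0 ≤ b)
    (hy : ∀ r, b * (bestAntennaGain F r * (forwardGain G r / (1 + forwardGain G r))) ≤ y) :
    (b / 2) ^ (Ns * R) * ((∏ p : Fin Ns × Fin R, min 1 (‖F p.1 p.2‖ ^ 2)) *
      ∏ p : Fin R × Fin Nd, min 1 (‖G p.1 p.2‖ ^ 2)) ≤ y ^ (Ns * R) := by
  have key : ∀ r, (b / 2) ^ Ns * ((∏ n, min 1 (‖F n r‖ ^ 2)) * ∏ j, min 1 (‖G r j‖ ^ 2)) ≤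
      y ^ Ns := fun r => by
    have hg := forwardGain_nonneg G r
    have hx := bestAntennaGain_nonneg F r
    calc _ = b ^ Ns * ((1 / 2) ^ Ns *
          ((∏ n, min 1 (‖F n r‖ ^ 2)) * ∏ j, min 1 (‖G r j‖ ^ 2))) := by ring
      _ ≤ b ^ Ns * (bestAntennaGain F r * (forwardGain G r / (1 + forwardGain G r))) ^ Ns := by
          gcongr
          exact prod_min_one_sq_le h r
      _ = (b * (bestAntennaGain F r * (forwardGain G r / (1 + forwardGain G r)))) ^ Ns := by ring
      _ ≤ y ^ Ns := by
          gcongr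
          exact hy r
  calc _ = ∏ r, ((b / 2) ^ Ns * ((∏ n, min 1 (‖F n r‖ ^ 2)) * ∏ j, min 1 (‖G r j‖ ^ 2))) := by
        rw [Fintype.prod_prod_type_right, Fintype.prod_prod_type, Finset.prod_mul_distrib,
          Finset.prod_mul_distrib]
        simp [pow_mul]
    _ ≤ ∏ _r : Fin R, y ^ Ns :=
        Finset.prod_le_prod (fun r _ => by positivity) fun r _ => key r
    _ = _ := by simp [pow_mul]

end Deterministic

/-! ### Probabilities and moments under Rayleigh fading -/

section Random

variable {Ω : Type*} [MeasurableSpace Ω] {Pr : Measure Ω} {Ns Nd R : ℕ}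
  {σf2 σg2 : Fin R → ℝ≥0} {f : Fin Ns → Fin R → Ω → ℂ} {g : Fin R → Fin Nd → Ω → ℂ}

lemma IsRayleighFading.aemeasurable_relayMetric (hfg : IsRayleighFading Pr σf2 σg2 f g)
    (m : Fin R → ℝ) (N₁ N₂ P₁ P₂ : ℝ) (r : Fin R) :
    AEMeasurable (fun ω => relayMetric m N₁ N₂ P₁ P₂ (fun n r => f n r ω)
      (fun r j => g r j ω) r) Pr := by
  have hf : ∀ n r, AEMeasurable (f n r) Pr := fun n r => (hfg.law_f n r).aemeasurable
  have hg : ∀ r j, AEMeasurable (g r j) Pr := fun r j => (hfg.law_g r j).aemeasurable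
  have h1 : AEMeasurable (fun ω => bestAntennaGain (fun n r => f n r ω) r) Pr :=
    AEMeasurable.iSup fun n => (hf n r).norm.pow_const 2
  have h2 : AEMeasurable (fun ω => forwardGain (fun r j => g r j ω) r) Pr :=
    Finset.aemeasurable_fun_sum _ fun j _ => (hg r j).norm.pow_const 2
  unfold relayMetric
  fun_prop

/-- The SER as the mean of a function of the best relay metric. -/
lemma averageSER_eq {N₁ N₂ P₁ P₂ : ℝ} (hN₁ : 0 < N₁) (h₁ : 0 ≤ P₁) (h₂ : 0 ≤ P₂) (c κ : ℝ)
    {rSel : Ω → Fin R} {nSel : Ω → Fin Ns}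
    (hsel : ∀ ω, IsFullOpportunistic (meanBestAntennaGain Pr f) N₁ N₂ P₁ P₂
      (fun n r => f n r ω) (fun r j => g r j ω) (rSel ω) (nSel ω)) :
    averageSER Pr f g N₁ N₂ c κ P₁ P₂ rSel nSel = ∫ ω, c * gaussianQ (Real.sqrt (κ *
      (P₁ * P₂ * ⨆ r, relayMetric (meanBestAntennaGain Pr f) N₁ N₂ P₁ P₂
        (fun n r => f n r ω) (fun r j => g r j ω) r))) ∂Pr := by
  refine integral_congr_ae (.of_forall fun ω => ?_)
  have hpos : ∀ r, 0 < meanBestAntennaGain Pr f r * P₁ + N₁ := fun r => by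
    have := meanBestAntennaGain_nonneg Pr f r
    positivity
  simp only [(hsel ω).receivedSNR_eq hpos h₂]

lemma exists_prob_forall_gain_le_ge [IsProbabilityMeasure Pr]
    (hfg : IsRayleighFading Pr σf2 σg2 f g) (hσf : ∀ r, 0 < σf2 r) :
    ∃ a > 0, ∀ δ ∈ Set.Icc (0 : ℝ) 1,
      a * δ ^ (Ns * R) ≤ Pr.real {ω | ∀ n r, ‖f n r ω‖ ^ 2 ≤ δ} := by
  choose a ha h using fun r => exists_rayleighLaw_ge (hσf r)
  refine ⟨∏ p : Fin Ns × Fin R, a p.2, Finset.prod_pos fun p _ => ha p.2, fun δ hδ => ?_⟩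
  have hind : iIndepFun (fun p : Fin Ns × Fin R => f p.1 p.2) Pr :=
    hfg.indep.precomp Sum.inl_injective
  have hms : MeasurableSet {z : ℂ | ‖z‖ ^ 2 ≤ δ} :=
    measurableSet_le (by fun_prop) measurable_const
  have hset : {ω | ∀ n r, ‖f n r ω‖ ^ 2 ≤ δ} =
      ⋂ p ∈ (Finset.univ : Finset (Fin Ns × Fin R)), f p.1 p.2 ⁻¹' {z : ℂ | ‖z‖ ^ 2 ≤ δ} := by
    ext ω
    simp [Prod.forall]
  rw [hset, Measure.real, hind.measure_inter_preimage_eq_mul _ fun _ _ => hms,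
    ENNReal.toReal_prod]
  calc (∏ p : Fin Ns × Fin R, a p.2) * δ ^ (Ns * R) = ∏ p : Fin Ns × Fin R, a p.2 * δ := by
        rw [Finset.prod_mul_distrib]
        simp
    _ ≤ _ := by
        refine Finset.prod_le_prod (fun p _ => mul_nonneg (ha _).le hδ.1) fun p _ => ?_
        refine (h p.2 δ hδ).trans (le_of_eq ?_)
        exact ((hfg.law_f p.1 p.2).measureReal_eq hms).symm

lemma lintegral_prod_gain_rpow_neg_lt_top (hfg : IsRayleighFading Pr σf2 σg2 f g)
    (hσf : ∀ r, 0 < σf2 r) (hσg : ∀ r, 0 < σg2 r) {β : ℝ} (h0 : 0 < β) (h1 : β < 1) :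
    ∫⁻ ω, ENNReal.ofReal ((∏ p : Fin Ns × Fin R, min 1 (‖f p.1 p.2 ω‖ ^ 2)) *
      ∏ p : Fin R × Fin Nd, min 1 (‖g p.1 p.2 ω‖ ^ 2)) ^ (-β) ∂Pr < ⊤ := by
  set Z := Sum.elim (fun p : Fin Ns × Fin R => f p.1 p.2) (fun p : Fin R × Fin Nd => g p.1 p.2)
  set ψ : ℂ → ENNReal := fun z => ENNReal.ofReal (min 1 (‖z‖ ^ 2)) ^ (-β)
  have hψ : Measurable ψ := by fun_prop
  have hm : ∀ i, AEMeasurable (Z i) Pr := by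
    rintro (p | p)
    · exact (hfg.law_f _ _).aemeasurable
    · exact (hfg.law_g _ _).aemeasurable
  have hprod : ∀ ω, ENNReal.ofReal ((∏ p : Fin Ns × Fin R, min 1 (‖f p.1 p.2 ω‖ ^ 2)) *
      ∏ p : Fin R × Fin Nd, min 1 (‖g p.1 p.2 ω‖ ^ 2)) ^ (-β) = ∏ i, ψ (Z i ω) := fun ω => by
    rw [ENNReal.prod_rpow_of_ne_top fun _ _ => ENNReal.ofReal_ne_top,
      ← ENNReal.ofReal_prod_of_nonneg fun _ _ => by positivity, Fintype.prod_sum_type]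
    rfl
  simp_rw [hprod]
  rw [lintegral_prod_eq_prod_lintegral_comp hfg.indep hm hψ]
  refine ENNReal.prod_lt_top fun i _ => ?_
  rcases i with p | p
  · exact ((hfg.law_f p.1 p.2).lintegral_comp hψ.aemeasurable).trans_lt
      (lintegral_rayleighLaw_min_rpow_neg_lt_top (hσf _) h0 h1)
  · exact ((hfg.law_g p.1 p.2).lintegral_comp hψ.aemeasurable).trans_lt
      (lintegral_rayleighLaw_min_rpow_neg_lt_top (hσg _) h0 h1)

lemma integrable_gaussianQ_sqrt [IsProbabilityMeasure Pr] {Y : Ω → ℝ} (hY : AEMeasurable Y Pr)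
    (c : ℝ) : Integrable (fun ω => c * gaussianQ (Real.sqrt (Y ω))) Pr := by
  refine Integrable.const_mul ?_ c
  refine Integrable.of_bound (C := gaussianQ 0) ?_ (.of_forall fun ω => ?_)
  · exact (gaussianQ_antitone.measurable.comp_aemeasurable hY.sqrt).aestronglyMeasurable
  · rw [Real.norm_of_nonneg (gaussianQ_nonneg _)]
    exact gaussianQ_antitone (Real.sqrt_nonneg _)

end Random

/-! ### Lower and upper bounds on the error rate -/

section AverageSER

variable {Ω : Type*} [MeasurableSpace Ω] {Pr : Measure Ω} [IsProbabilityMeasure Pr] {Ns Nd R : ℕ}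
  {σf2 σg2 : Fin R → ℝ≥0} {f : Fin Ns → Fin R → Ω → ℂ} {g : Fin R → Fin Nd → Ω → ℂ}
  {N₁ N₂ c κ : ℝ}

lemma le_averageSER (hfg : IsRayleighFading Pr σf2 σg2 f g) (hNs : 0 < Ns) (hR : 0 < R)
    (hN₁ : 0 < N₁) (hN₂ : 0 < N₂) (hc : 0 < c) (hκ : 0 < κ) {P P₁ P₂ : ℝ} (hP : 1 ≤ P)
    (h₁ : 0 ≤ P₁) (h₁' : P₁ ≤ P) (h₂ : 0 ≤ P₂) {rSel : Ω → Fin R} {nSel : Ω → Fin Ns}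
    (hsel : ∀ ω, IsFullOpportunistic (meanBestAntennaGain Pr f) N₁ N₂ P₁ P₂
      (fun n r => f n r ω) (fun r j => g r j ω) (rSel ω) (nSel ω)) :
    c * gaussianQ (Real.sqrt (κ / N₁)) * Pr.real {ω | ∀ n r, ‖f n r ω‖ ^ 2 ≤ P⁻¹} ≤
      averageSER Pr f g N₁ N₂ c κ P₁ P₂ rSel nSel := by
  have : Nonempty (Fin R) := ⟨⟨0, hR⟩⟩
  have : Nonempty (Fin Ns) := ⟨⟨0, hNs⟩⟩
  have hP0 : 0 < P := by linarith
  rw [averageSER_eq hN₁ h₁ h₂ c κ hsel]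
  have hmeas : AEMeasurable (fun ω => κ * (P₁ * P₂ * ⨆ r,
      relayMetric (meanBestAntennaGain Pr f) N₁ N₂ P₁ P₂
        (fun n r => f n r ω) (fun r j => g r j ω) r)) Pr :=
    ((AEMeasurable.iSup fun r => hfg.aemeasurable_relayMetric _ N₁ N₂ P₁ P₂ r).const_mul
      _).const_mul _
  -- Markov's inequality at the level `c Q(√(κ / N₁))`, which the integrand reaches wherever the SNR
  -- is at most `1 / N₁`.
  refine le_trans ?_ (mul_meas_ge_le_integral_of_nonneg
    (.of_forall fun ω => mul_nonneg hc.le (gaussianQ_nonneg _)) (integrable_gaussianQ_sqrt hmeas c)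
    (c * gaussianQ (Real.sqrt (κ / N₁))))
  refine mul_le_mul_of_nonneg_left (measureReal_mono fun ω hω => ?_)
    (mul_nonneg hc.le (gaussianQ_nonneg _))
  refine mul_le_mul_of_nonneg_left (gaussianQ_antitone (Real.sqrt_le_sqrt ?_)) hc.le
  rw [div_eq_mul_inv]
  refine mul_le_mul_of_nonneg_left ?_ hκ.le
  rw [Real.mul_iSup_of_nonneg (mul_nonneg h₁ h₂)]
  refine ciSup_le fun r => (mul_relayMetric_le (meanBestAntennaGain_nonneg Pr f) hN₁ hN₂ h₁ h₂
    r).trans ?_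
  rw [div_eq_mul_inv]
  refine mul_le_of_le_one_left (inv_nonneg.2 hN₁.le) ?_
  have hb : bestAntennaGain (fun n r => f n r ω) r ≤ P⁻¹ := ciSup_le fun n => hω n r
  calc P₁ * bestAntennaGain (fun n r => f n r ω) r ≤ P * P⁻¹ :=
        mul_le_mul h₁' hb (bestAntennaGain_nonneg _ _) hP0.le
    _ = 1 := mul_inv_cancel₀ hP0.ne'

/-- The constant is chosen before the powers and the selection maps, since all of these vary with
the transmit SNR. -/
lemma exists_averageSER_le (hfg : IsRayleighFading Pr σf2 σg2 f g) (hNs : 0 < Ns) (hR : 0 < R)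
    (hle : Ns ≤ Nd) (hσf : ∀ r, 0 < σf2 r) (hσg : ∀ r, 0 < σg2 r)
    (hN₁ : 0 < N₁) (hN₂ : 0 < N₂) (hc : 0 < c) (hκ : 0 < κ) {ε β : ℝ} (hε : 0 < ε)
    (hβ0 : 0 < β) (hβ1 : β < 1) :
    ∃ C > 0, ∀ (P P₁ P₂ : ℝ) (rSel : Ω → Fin R) (nSel : Ω → Fin Ns), 1 ≤ P → ε * P ≤ P₁ →
      P₁ ≤ P → ε * P ≤ P₂ → P₂ ≤ P →
      (∀ ω, IsFullOpportunistic (meanBestAntennaGain Pr f) N₁ N₂ P₁ P₂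
        (fun n r => f n r ω) (fun r j => g r j ω) (rSel ω) (nSel ω)) →
      averageSER Pr f g N₁ N₂ c κ P₁ P₂ rSel nSel ≤ C * P ^ (-(((Ns * R : ℕ) : ℝ) * β)) := by
  set N := Ns * R
  have hN0 : (0 : ℝ) < N := by exact_mod_cast Nat.mul_pos hNs hR
  obtain ⟨A, hA, hQ⟩ := exists_gaussianQ_sqrt_le (mul_pos hN0 hβ0)
  set m := meanBestAntennaGain Pr f
  have hm : ∀ r, 0 ≤ m r := meanBestAntennaGain_nonneg Pr f
  set W : Ω → ℝ := fun ω => (∏ p : Fin Ns × Fin R, min 1 (‖f p.1 p.2 ω‖ ^ 2)) *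
      ∏ p : Fin R × Fin Nd, min 1 (‖g p.1 p.2 ω‖ ^ 2)
  have hW0 : ∀ ω, 0 ≤ W ω := fun ω => by positivity
  have hI := lintegral_prod_gain_rpow_neg_lt_top hfg hσf hσg hβ0 hβ1
  set I := ∫⁻ ω, ENNReal.ofReal (W ω) ^ (-β) ∂Pr
  -- Half the coefficient of `P` in the lower bound for `y`: `prod_gain_le_pow`, applied with `2 * b
  -- * P`, loses a factor `2`.
  set b := κ * (ε ^ 2 / (N₁ + Nd * N₂ * ((∑ k, m k) + N₁))) / 2 with hb
  have hb0 : 0 < b := by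
    have := Finset.sum_nonneg fun k (_ : k ∈ Finset.univ) => hm k
    positivity
  refine ⟨c * A * b ^ (-(N * β)) * (I.toReal + 1), by positivity, ?_⟩
  intro P P₁ P₂ rSel nSel hP h₁ h₁' h₂ h₂' hsel
  have hP0 : 0 < P := by linarith
  have hP₁ : 0 ≤ P₁ := (by positivity : 0 ≤ ε * P).trans h₁
  have hP₂ : 0 ≤ P₂ := (by positivity : 0 ≤ ε * P).trans h₂
  have : Nonempty (Fin R) := ⟨⟨0, hR⟩⟩
  rw [averageSER_eq hN₁ hP₁ hP₂ c κ hsel]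
  set y : Ω → ℝ := fun ω => κ * (P₁ * P₂ * ⨆ r, relayMetric m N₁ N₂ P₁ P₂
        (fun n r => f n r ω) (fun r j => g r j ω) r)
  have hmeas : AEMeasurable y Pr :=
    ((AEMeasurable.iSup fun r => hfg.aemeasurable_relayMetric _ N₁ N₂ P₁ P₂ r).const_mul
      _).const_mul _
  have hyr : ∀ ω r, (κ * (ε ^ 2 / (N₁ + Nd * N₂ * ((∑ k, m k) + N₁)))) * P *
      (bestAntennaGain (fun n r => f n r ω) r * (forwardGain (fun r j => g r j ω) r /
        (1 + forwardGain (fun r j => g r j ω) r))) ≤ y ω := fun ω r => by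
    rw [mul_assoc, mul_assoc, ← mul_assoc _ P]
    refine mul_le_mul_of_nonneg_left ?_ hκ.le
    refine (le_mul_relayMetric hm hN₁ hN₂ hε hP h₁ h₁' h₂ h₂' (hNs.trans_le hle) r).trans ?_
    exact mul_le_mul_of_nonneg_left (le_ciSup (f := fun r => relayMetric m N₁ N₂ P₁ P₂
      (fun n r => f n r ω) (fun r j => g r j ω) r) (Set.finite_range _).bddAbove r) (by positivity)
  have hyW : ∀ ω, (b * P) ^ N * W ω ≤ y ω ^ N := fun ω => by
    have := prod_gain_le_pow (F := fun n r => f n r ω) (G := fun r j => g r j ω) hle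
      (b := 2 * b * P) (y := y ω) (by positivity) (fun r => by
        rw [show 2 * b = κ * (ε ^ 2 / (N₁ + Nd * N₂ * ((∑ k, m k) + N₁))) by rw [hb]; ring]
        exact hyr ω r)
    rwa [show 2 * b * P / 2 = b * P by ring] at this
  have hy0 : ∀ ω, 0 ≤ y ω := fun ω => by
    refine le_trans ?_ (hyr ω ⟨0, hR⟩)
    have := bestAntennaGain_nonneg (fun n r => f n r ω) ⟨0, hR⟩
    have := forwardGain_nonneg (fun r j => g r j ω) ⟨0, hR⟩
    have : 0 < κ * (ε ^ 2 / (N₁ + Nd * N₂ * ((∑ k, m k) + N₁))) := by linarith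
    positivity
  have hpt : ∀ ω, ENNReal.ofReal (c * gaussianQ (Real.sqrt (y ω))) ≤
      ENNReal.ofReal (c * A * (b * P) ^ (-(N * β))) * ENNReal.ofReal (W ω) ^ (-β) := by
    intro ω
    -- Where `W` vanishes, `0 ^ (-β) = ⊤` makes the bound trivial.
    rcases (hW0 ω).eq_or_lt with h | h
    · rw [← h, ENNReal.ofReal_zero, ENNReal.zero_rpow_of_neg (by linarith), ENNReal.mul_top]
      · exact le_top
      · exact (ENNReal.ofReal_pos.2 (by positivity)).ne'
    · have hyN : 0 < y ω ^ N := (by positivity : 0 < (b * P) ^ N * W ω).trans_le (hyW ω)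
      have hypos : 0 < y ω := (hy0 ω).lt_of_ne fun h0 => by
        rw [← h0, zero_pow (Nat.mul_pos hNs hR).ne'] at hyN
        exact lt_irrefl _ hyN
      rw [ENNReal.ofReal_rpow_of_pos h, ← ENNReal.ofReal_mul (by positivity)]
      refine ENNReal.ofReal_le_ofReal ?_
      rw [mul_assoc, mul_assoc]
      refine mul_le_mul_of_nonneg_left ((hQ _ hypos).trans ?_) hc.le
      refine mul_le_mul_of_nonneg_left ?_ hA.le
      -- Writing `y ^ (-(N β))` as `(y ^ N) ^ (-β)` brings in `hyW`, and the negative exponent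
      -- reverses it.
      rw [neg_mul_eq_mul_neg, Real.rpow_mul hypos.le, Real.rpow_mul (by positivity),
        Real.rpow_natCast, Real.rpow_natCast, ← Real.mul_rpow (by positivity) h.le]
      exact Real.rpow_le_rpow_of_nonpos (by positivity) (hyW ω) (by linarith)
  rw [integral_eq_lintegral_of_nonneg_ae
    (.of_forall fun ω => mul_nonneg hc.le (gaussianQ_nonneg _))
    (integrable_gaussianQ_sqrt hmeas c).aestronglyMeasurable]
  have hle : ∫⁻ ω, ENNReal.ofReal (c * gaussianQ (Real.sqrt (y ω))) ∂Pr ≤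
      ENNReal.ofReal (c * A * (b * P) ^ (-(N * β))) * I := by
    refine (lintegral_mono hpt).trans (le_of_eq ?_)
    exact lintegral_const_mul' _ _ ENNReal.ofReal_ne_top
  refine (ENNReal.toReal_mono (ENNReal.mul_ne_top ENNReal.ofReal_ne_top hI.ne) hle).trans ?_
  rw [ENNReal.toReal_mul, ENNReal.toReal_ofReal (by positivity),
    Real.mul_rpow hb0.le hP0.le]
  have : 0 ≤ c * A * b ^ (-(N * β)) * P ^ (-(N * β)) := by positivity
  linarith

end AverageSER

/-- Total power `P = μ N₀` at transmit SNR `μ` (relative to a fixed reference noise power `N₀`) is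
split as `P₁ = τ P`, `P₂ = (1 - τ) P`; the ratio `τ` may depend on `P` but stays away from `0` and
`1`. `c`, `κ` are the modulation constants: `c = 2`, `κ = 2 sin² (π / M)` for M-PSK and
`c = 4 (√M - 1) / √M`, `κ = 3 / (M - 1)` for M-QAM. -/
theorem corollary2 {Ω : Type*} [MeasurableSpace Ω] (Pr : Measure Ω) [IsProbabilityMeasure Pr]
    (Ns Nd R : ℕ) (hNs : 0 < Ns) (hR : 0 < R) (hlt : Ns < Nd)
    (σf2 σg2 : Fin R → ℝ≥0) (hσf : ∀ r, 0 < σf2 r) (hσg : ∀ r, 0 < σg2 r)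
    (f : Fin Ns → Fin R → Ω → ℂ) (g : Fin R → Fin Nd → Ω → ℂ)
    (hfg : IsRayleighFading Pr σf2 σg2 f g)
    (N₀ N₁ N₂ c κ : ℝ) (hN₀ : 0 < N₀) (hN₁ : 0 < N₁) (hN₂ : 0 < N₂) (hc : 0 < c) (hκ : 0 < κ)
    (τ : ℝ → ℝ) (hτ : ∃ ε > 0, ∀ᶠ P in atTop, ε ≤ τ P ∧ τ P ≤ 1 - ε)
    (rSel : ℝ → Ω → Fin R) (nSel : ℝ → Ω → Fin Ns)
    (hsel : ∀ P ω, 0 < P → IsFullOpportunistic (meanBestAntennaGain Pr f) N₁ N₂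
      (τ P * P) ((1 - τ P) * P) (fun n r => f n r ω) (fun r j => g r j ω) (rSel P ω) (nSel P ω)) :
    HasDiversityOrder
      (fun μ => averageSER Pr f g N₁ N₂ c κ (τ (μ * N₀) * (μ * N₀)) ((1 - τ (μ * N₀)) * (μ * N₀))
        (rSel (μ * N₀)) (nSel (μ * N₀)))
      ((Ns * R : ℕ) : ℝ) := by

  have hN : (0 : ℝ) < ((Ns * R : ℕ) : ℝ) := by exact_mod_cast Nat.mul_pos hNs hR
  obtain ⟨ε, hε, hτ⟩ := hτ
  have hev : ∀ᶠ μ in atTop, 0 < μ ∧ 1 ≤ μ * N₀ ∧ ε ≤ τ (μ * N₀) ∧ τ (μ * N₀) ≤ 1 - ε := by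
    have ht : Tendsto (fun μ : ℝ => μ * N₀) atTop atTop := tendsto_id.atTop_mul_const hN₀
    filter_upwards [eventually_gt_atTop 0, ht.eventually_ge_atTop 1, ht.eventually hτ]
      with μ h1 h2 h3 using ⟨h1, h2, h3⟩
  refine hasDiversityOrder_of_le hN ?_ fun β hβ0 hβ1 => ?_
  · obtain ⟨a, ha, hprob⟩ := exists_prob_forall_gain_le_ge hfg hσf
    have hQ := gaussianQ_pos (Real.sqrt (κ / N₁))
    -- The power of `N₀⁻¹` converts `P = μ N₀` back to `μ`.
    refine ⟨c * gaussianQ (Real.sqrt (κ / N₁)) * (a * N₀⁻¹ ^ (Ns * R)), by positivity, ?_⟩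
    filter_upwards [hev] with μ ⟨hμ, hP, hτ1, hτ2⟩
    have hP0 : 0 < μ * N₀ := by positivity
    refine le_trans ?_ (le_averageSER hfg hNs hR hN₁ hN₂ hc hκ hP
      (mul_nonneg (by linarith) hP0.le) (mul_le_of_le_one_left hP0.le (by linarith))
      (mul_nonneg (by linarith) hP0.le) fun ω => hsel _ ω hP0)
    rw [mul_assoc]
    refine mul_le_mul_of_nonneg_left ?_ (by positivity)
    refine le_trans (le_of_eq ?_) (hprob (μ * N₀)⁻¹ ⟨by positivity, inv_le_one_of_one_le₀ hP⟩)
    rw [Real.rpow_neg hμ.le, Real.rpow_natCast, mul_inv, mul_pow, inv_pow μ]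
    ring
  · obtain ⟨C, hC, hle⟩ := exists_averageSER_le hfg hNs hR hlt.le hσf hσg hN₁ hN₂ hc hκ hε hβ0 hβ1
    refine ⟨C * N₀ ^ (-(((Ns * R : ℕ) : ℝ) * β)), by positivity, ?_⟩
    filter_upwards [hev] with μ ⟨hμ, hP, hτ1, hτ2⟩
    have hP0 : 0 < μ * N₀ := by positivity
    refine (hle (μ * N₀) _ _ _ _ hP (mul_le_mul_of_nonneg_right hτ1 hP0.le)
      (mul_le_of_le_one_left hP0.le (by linarith))
      (mul_le_mul_of_nonneg_right (by linarith) hP0.le)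
      (mul_le_of_le_one_left hP0.le (by linarith)) fun ω => hsel _ ω hP0).trans (le_of_eq ?_)
    rw [Real.mul_rpow hμ.le hN₀.le]
    ring
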